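/- Let $K$ be a field. For a monic polynomial $P=X^d+a_{d-1}X^{d-1}+\dots+a_0\in K[X]$ of degree $d\ge 1$ let $[P]\in\operatorname{M}_d(K)$ be its companion matrix (ones directly below the diagonal, last column $(-a_0,\dots,-a_{d-1})^t$, zeros elsewhere), and let $\sigma\oplus\tau$ denote the block diagonal matrix with blocks $\sigma,\tau$. Let $\operatorname{GL}_\infty(K)=\varinjlim_{n\ge 1}\operatorname{GL}_n(K)$ with respect to the transition homomorphisms $\operatorname{GL}_n(K)\to\operatorname{GL}_{n+k}(K)$, $\sigma\mapsto e_{k\times k}\oplus\sigma$, where $e_{k\times k}$ is the identity matrix, and write $[\sigma]_\infty$ for the class of $\sigma\in\operatorname{GL}_n(K)$. For $\sigma\in\operatorname{GL}_\infty(K)$ let $n_\sigma$ be the least positive integer $n$ such that $\sigma$ has a representative in $\operatorname{GL}_n(K)$, and for $n\ge n_\sigma$ let $\sigma^{(n)}$ be the unique representative of $\sigma$ in $\operatorname{GL}_n(K)$. Then the following hold. 1. For every $n\ge 1$ and every $A\in\operatorname{M}_n(K)$ there is exactly one finite sequence $P_1,\dots,P_r$ of nonconstant monic polynomials in $K[X]$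 with $P_1\mid P_2\mid\dots\mid P_r$ such that $A$ is similar to $F(A):=[P_1]\oplus\dots\oplus[P_r]$ (the Frobenius form of $A$). 2. For every $\sigma\in\operatorname{GL}_\infty(K)$ there is an $s\ge n_\sigma$ such that $[F(\sigma^{(s)})]_\infty=[F(\sigma^{(t)})]_\infty$ for all $t\ge s$. Hence the stabilized Frobenius form $F(\sigma):=[F(\sigma^{(s)})]_\infty\in\operatorname{GL}_\infty(K)$ is well defined, that is, it does not depend on the choice of such an $s$. 3. For all $\sigma,\tau\in\operatorname{GL}_\infty(K)$: $\sigma$ and $\tau$ are conjugate in $\operatorname{GL}_\infty(K)$ if and only if $F(\sigma)=F(\tau)$. -/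

import Mathlib

open Polynomial

noncomputable section

namespace StableGL

/-- The companion matrix `[P]` of `P = X^d + a_{d-1} X^{d-1} + ... + a_0`, `d = P.natDegree`:
ones below the diagonal, last column `(-a_0, ..., -a_{d-1})`. (Used for monic `P` only.) -/
def companion {K : Type*} [Field K] (P : K[X]) :
    Matrix (Fin P.natDegree) (Fin P.natDegree) K :=
  Matrix.of fun i j =>
    if (j : ℕ) + 1 = P.natDegree then -P.coeff i
    else if (i : ℕ) = (j : ℕ) + 1 then 1 else 0

/-- The direct sum `σ ⊕ τ` of square matrices: block diagonal, `σ` in the upper left corner. -/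
def directSum {K : Type*} [Field K] {m n : ℕ}
    (σ : Matrix (Fin m) (Fin m) K) (τ : Matrix (Fin n) (Fin n) K) :
    Matrix (Fin (m + n)) (Fin (m + n)) K :=
  Matrix.reindex finSumFinEquiv finSumFinEquiv (Matrix.fromBlocks σ 0 0 τ)

/-- A square matrix of size `m` regarded as one of size `n`, where `m = n`. -/
def castSize {K : Type*} {m n : ℕ} (h : m = n) (σ : Matrix (Fin m) (Fin m) K) :
    Matrix (Fin n) (Fin n) K :=
  Matrix.reindex (finCongr h) (finCongr h) σ

/-- `[P₁] ⊕ ... ⊕ [P_r]` for a list `P₁, ..., P_r` of polynomials. -/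
def companionSum {K : Type*} [Field K] : (L : List K[X]) →
    Matrix (Fin (L.map natDegree).sum) (Fin (L.map natDegree).sum) K
  | [] => 0
  | P :: L => castSize (by simp) (directSum (companion P) (companionSum L))

/-- Similarity of square matrices: `σ = ρ τ ρ⁻¹` for some invertible `ρ`. -/
def Similar {K : Type*} [Field K] {n : ℕ} (σ τ : Matrix (Fin n) (Fin n) K) : Prop :=
  ∃ ρ : GL (Fin n) K,
    σ = (ρ : Matrix (Fin n) (Fin n) K) * τ * ((ρ⁻¹ : GL (Fin n) K) : Matrix (Fin n) (Fin n) K)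

/-- `L = P₁, ..., P_r` consists of nonconstant monic polynomials with `P₁ ∣ P₂ ∣ ... ∣ P_r`,
and `σ` is similar to `[P₁] ⊕ ... ⊕ [P_r]`. -/
structure IsInvariantFactors {K : Type*} [Field K] {n : ℕ}
    (σ : Matrix (Fin n) (Fin n) K) (L : List K[X]) : Prop where
  monic : ∀ P ∈ L, P.Monic
  nonconstant : ∀ P ∈ L, 0 < P.natDegree
  chain : L.IsChain (· ∣ ·)
  similar : ∃ h : (L.map natDegree).sum = n, Similar σ (castSize h (companionSum L))

open Classical in
/-- The Frobenius form `F(σ) = [P₁] ⊕ ... ⊕ [P_r]` of `σ`, where `P₁, ..., P_r` are the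
invariant factors of `σ`. The second branch is never taken, since every matrix has
invariant factors. -/
def frobeniusForm {K : Type*} [Field K] {n : ℕ} (σ : Matrix (Fin n) (Fin n) K) :
    Matrix (Fin n) (Fin n) K :=
  if h : ∃ L : List K[X], IsInvariantFactors σ L then
    castSize h.choose_spec.similar.choose (companionSum h.choose)
  else σ

theorem similar_frobeniusForm {K : Type*} [Field K] {n : ℕ} (σ : Matrix (Fin n) (Fin n) K) :
    Similar σ (frobeniusForm σ) := by
  unfold frobeniusForm
  split_ifs with h
  · exact h.choose_spec.similar.choose_spec
  · exact ⟨1, by simp⟩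

theorem isUnit_frobeniusForm {K : Type*} [Field K] {n : ℕ} (σ : GL (Fin n) K) :
    IsUnit (frobeniusForm (σ : Matrix (Fin n) (Fin n) K)) := by
  obtain ⟨ρ, hρ⟩ := similar_frobeniusForm (σ : Matrix (Fin n) (Fin n) K)
  generalize frobeniusForm (σ : Matrix (Fin n) (Fin n) K) = F at hρ ⊢
  refine ⟨ρ⁻¹ * σ * ρ, ?_⟩
  rw [Units.val_mul, Units.val_mul, hρ, ← mul_assoc, ← mul_assoc, Units.inv_mul, one_mul,
    mul_assoc, Units.inv_mul, mul_one]

/-- The Frobenius form of an invertible matrix, as an invertible matrix. -/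
def frobeniusGL {K : Type*} [Field K] {n : ℕ} (σ : GL (Fin n) K) : GL (Fin n) K :=
  (isUnit_frobeniusForm σ).unit

/-- For `m ≤ n`, the matrix `e ⊕ σ` of size `n`, where `e` is the identity matrix of
size `n - m`. -/
def pad {K : Type*} [Field K] {m n : ℕ} (h : m ≤ n) (σ : Matrix (Fin m) (Fin m) K) :
    Matrix (Fin n) (Fin n) K :=
  castSize (Nat.sub_add_cancel h) (directSum (1 : Matrix (Fin (n - m)) (Fin (n - m)) K) σ)

theorem pad_one {K : Type*} [Field K] {m n : ℕ} (h : m ≤ n) :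
    pad h (1 : Matrix (Fin m) (Fin m) K) = 1 := by
  simp [pad, castSize, directSum, Matrix.fromBlocks_one]

theorem pad_mul {K : Type*} [Field K] {m n : ℕ} (h : m ≤ n)
    (σ τ : Matrix (Fin m) (Fin m) K) : pad h (σ * τ) = pad h σ * pad h τ := by
  simp only [pad, castSize, directSum, Matrix.reindex_apply, Matrix.submatrix_mul_equiv,
    Matrix.fromBlocks_multiply]
  simp

theorem pad_apply {K : Type*} [Field K] {m n : ℕ} (h : m ≤ n)
    (σ : Matrix (Fin m) (Fin m) K) (i j : Fin n) :
    pad h σ i j = if H : n - m ≤ i ∧ n - m ≤ j then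
      σ ⟨i - (n - m), by omega⟩ ⟨j - (n - m), by omega⟩ else if i = j then 1 else 0 := by
  have key : ∀ i : Fin (n - m + m), (∃ a : Fin (n - m), i = Fin.castAdd m a) ∨
      (∃ a : Fin m, i = Fin.natAdd (n - m) a) := fun i =>
    Fin.addCases (fun a => Or.inl ⟨a, rfl⟩) (fun a => Or.inr ⟨a, rfl⟩) i
  obtain ⟨i, rfl⟩ := (finCongr (Nat.sub_add_cancel h)).surjective i
  obtain ⟨j, rfl⟩ := (finCongr (Nat.sub_add_cancel h)).surjective j
  rcases key i with ⟨a, rfl⟩ | ⟨a, rfl⟩ <;> rcases key j with ⟨b, rfl⟩ | ⟨b, rfl⟩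
  · have : ¬ (n - m ≤ (a : ℕ)) := by omega
    simp [pad, castSize, directSum, Matrix.one_apply, this, Fin.ext_iff]
  · have : ¬ (n - m ≤ (a : ℕ)) := by omega
    have h2 : ¬ ((a : ℕ) = n - m + b) := by omega
    simp [pad, castSize, directSum, this, h2, Fin.ext_iff]
  · have : ¬ (n - m ≤ (b : ℕ)) := by omega
    have h2 : ¬ (n - m + a = (b : ℕ)) := by omega
    simp [pad, castSize, directSum, this, h2, Fin.ext_iff]
  · simp [pad, castSize, directSum]

theorem pad_self {K : Type*} [Field K] {m : ℕ} (σ : Matrix (Fin m) (Fin m) K) :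
    pad le_rfl σ = σ := by
  ext i j
  simp [pad_apply]

theorem pad_pad {K : Type*} [Field K] {l m n : ℕ} (h : l ≤ m) (h' : m ≤ n)
    (σ : Matrix (Fin l) (Fin l) K) : pad h' (pad h σ) = pad (h.trans h') σ := by
  ext i j
  simp only [pad_apply, Fin.ext_iff]
  split_ifs <;> first | rfl | omega | (congr 2 <;> omega)

theorem pad_injective {K : Type*} [Field K] {m n : ℕ} (h : m ≤ n) :
    Function.Injective (pad (K := K) h) := by
  intro σ τ e
  have := (Matrix.reindex _ _).injective ((Matrix.reindex _ _).injective e)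
  exact (Matrix.fromBlocks_inj.1 this).2.2.2

/-- The transition homomorphism `GL_m(K) → GL_n(K)`, `σ ↦ e ⊕ σ`, for `m ≤ n`. -/
def transition (K : Type*) [Field K] (m n : ℕ+) (h : m ≤ n) :
    GL (Fin m) K →* GL (Fin n) K :=
  Units.map
    { toFun := pad (show (m : ℕ) ≤ n from h)
      map_one' := pad_one _
      map_mul' := pad_mul _ }

instance directedSystem (K : Type*) [Field K] :
    DirectedSystem (fun n : ℕ+ => GL (Fin n) K) (transition K · · ·) where
  map_self _ _ := Units.ext (pad_self _)
  map_map k j i h h' _ :=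
    Units.ext (pad_pad (show (i : ℕ) ≤ j from h) (show (j : ℕ) ≤ k from h') _)

/-- The stable general linear group `GL_∞(K)`: the direct limit of the groups `GL_n(K)`,
`n = 1, 2, ...`, along the transition homomorphisms `σ ↦ e ⊕ σ`. -/
abbrev GLInf (K : Type*) [Field K] : Type _ :=
  DirectLimit (fun n : ℕ+ => GL (Fin n) K) (transition K)

/-- The class `[σ]_∞` in `GL_∞(K)` of an invertible matrix `σ`. -/
def stableClass {K : Type*} [Field K] {n : ℕ+} (σ : GL (Fin n) K) : GLInf K := ⟦⟨n, σ⟩⟧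

theorem stableClass_transition {K : Type*} [Field K] {m n : ℕ+} (h : m ≤ n)
    (σ : GL (Fin m) K) : stableClass (transition K m n h σ) = stableClass σ :=
  DirectLimit.mk_apply (F := fun n : ℕ+ => GL (Fin n) K) (f := transition K) m n σ h

theorem stableClass_injective {K : Type*} [Field K] {n : ℕ+} :
    Function.Injective (stableClass : GL (Fin n) K → GLInf K) := by
  intro σ τ e
  obtain ⟨k, h, _, e'⟩ := Quotient.exact e
  replace e' : transition K n k h σ = transition K n k h τ := e'
  exact Units.ext (pad_injective h (Units.ext_iff.1 e'))

theorem exists_representative {K : Type*} [Field K] (σ : GLInf K) :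
    ∃ n : ℕ+, ∃ A : GL (Fin n) K, stableClass A = σ := by
  obtain ⟨n, A, rfl⟩ := DirectLimit.exists_eq_mk _ σ
  exact ⟨n, A, rfl⟩

open Classical in
/-- `n_σ`: the least positive integer `n` such that `σ` has a representative in `GL_n(K)`. -/
def minSize {K : Type*} [Field K] (σ : GLInf K) : ℕ+ := PNat.find (exists_representative σ)

theorem existsUnique_representative {K : Type*} [Field K] (σ : GLInf K) (n : ℕ+)
    (h : minSize σ ≤ n) : ∃! A : GL (Fin n) K, stableClass A = σ := by
  obtain ⟨A, hA⟩ : ∃ A : GL (Fin (minSize σ)) K, stableClass A = σ := by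
    classical
    exact PNat.find_spec (exists_representative σ)
  refine ⟨transition K _ n h A, (stableClass_transition h A).trans hA, fun B hB => ?_⟩
  exact stableClass_injective (hB.trans ((stableClass_transition h A).trans hA).symm)

/-- `σ^(n)`: the unique representative of `σ` in `GL_n(K)`, for `n ≥ n_σ`. -/
def representative {K : Type*} [Field K] (σ : GLInf K) (n : ℕ+) (h : minSize σ ≤ n) :
    GL (Fin n) K :=
  (existsUnique_representative σ n h).choose

/-- `s ≥ n_σ`, and `[F(σ^(s))]_∞ = [F(σ^(t))]_∞` for all `t ≥ s`. -/
def StabilizesAt {K : Type*} [Field K] (σ : GLInf K) (s : ℕ+) : Prop :=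
  ∃ hs : minSize σ ≤ s, ∀ (t : ℕ+) (ht : s ≤ t),
    stableClass (frobeniusGL (representative σ s hs)) =
      stableClass (frobeniusGL (representative σ t (hs.trans ht)))

open Classical in
/-- The stabilized Frobenius form `F(σ) = [F(σ^(s))]_∞` of `σ ∈ GL_∞(K)`, for any `s` from which
on the classes `[F(σ^(n))]_∞` no longer change. The second branch is never taken, since such an
`s` exists. -/
def stableFrobeniusForm {K : Type*} [Field K] (σ : GLInf K) : GLInf K :=
  if h : ∃ s : ℕ+, StabilizesAt σ s then
    stableClass (frobeniusGL (representative σ h.choose h.choose_spec.choose))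
  else 1

end StableGL

end

/-
A square matrix `σ` is studied through the `K[X]`-module on which `X` acts by `σ`: similarity is
isomorphism of modules, and `[P₁] ⊕ ⋯ ⊕ [Pᵣ]` corresponds to `K[X]/(P₁) ⊕ ⋯ ⊕ K[X]/(Pᵣ)`.
Replacing `R/(a) ⊕ R/(b)` by `R/(gcd a b) ⊕ R/(lcm a b)` step by step turns any sum of cyclic
modules into one whose generators form a divisibility chain. For such a chain, the number of `aᵢ`
not dividing `x` is the minimal number of generators of `x • (R/(a₁) ⊕ ⋯ ⊕ R/(aᵣ))`, so it depends
on the module alone, and these numbers for all `x` determine the chain.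

Passing from `GL_m` to `GL_n` adds `n - m` summands `K[X]/(X - 1)`. Pairing them with the invariant
factors by the same gcd-lcm exchange makes every invariant factor divisible by `X - 1` as soon as
there are enough of them. From then on further factors `X - 1` are simply prepended to the chain,
so that taking Frobenius forms commutes with the transition maps.
-/

noncomputable section

namespace StableGL

section CyclicSum

variable {R : Type*} [CommRing R]

/-- The direct sum of the cyclic modules `R/(a)`, for `a` in the list `L`. -/
abbrev CyclicSum (L : List R) : Type _ := ∀ i : Fin L.length, R ⧸ Ideal.span {L.get i}

/-- `M` is isomorphic to the direct sum of the cyclic modules `R/(a)`, for `a` in the list `L`.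
No condition is imposed on `L`: its members may be units or zero. -/
def HasCyclicFactors (M : Type*) [AddCommGroup M] [Module R M] (L : List R) : Prop :=
  Nonempty (M ≃ₗ[R] CyclicSum L)

/-- The lists `L` and `L'` present the same direct sum of cyclic modules, up to isomorphism. -/
def CyclicEquiv (L L' : List R) : Prop := HasCyclicFactors (CyclicSum L) L'

section HasCyclicFactors

variable {M N : Type*} [AddCommGroup M] [Module R M] [AddCommGroup N] [Module R N] {L L' : List R}

theorem HasCyclicFactors.of_linearEquiv (e : M ≃ₗ[R] N) (h : HasCyclicFactors N L) :
    HasCyclicFactors M L :=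
  h.map e.trans

theorem HasCyclicFactors.nonempty_linearEquiv (h : HasCyclicFactors M L)
    (h' : HasCyclicFactors N L) : Nonempty (M ≃ₗ[R] N) :=
  ⟨h.some.trans h'.some.symm⟩

theorem HasCyclicFactors.trans (h : HasCyclicFactors M L) (h' : CyclicEquiv L L') :
    HasCyclicFactors M L' :=
  h'.of_linearEquiv h.some

theorem HasCyclicFactors.cyclicEquiv (h : HasCyclicFactors M L) (h' : HasCyclicFactors M L') :
    CyclicEquiv L L' :=
  h'.of_linearEquiv h.some.symm

theorem hasCyclicFactors_nil [Subsingleton M] : HasCyclicFactors M ([] : List R) :=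
  have : IsEmpty (Fin ([] : List R).length) := Fin.isEmpty
  ⟨LinearEquiv.ofSubsingleton _ _⟩

theorem HasCyclicFactors.prod_cons {a : R} (e : M ≃ₗ[R] R ⧸ Ideal.span {a})
    (h : HasCyclicFactors N L) : HasCyclicFactors (M × N) (a :: L) :=
  h.map fun e' => (e.prodCongr e').trans
    (Fin.consLinearEquiv R fun i : Fin (a :: L).length => R ⧸ Ideal.span {(a :: L).get i})

theorem hasCyclicFactors_append (L L' : List R) :
    HasCyclicFactors (CyclicSum L × CyclicSum L') (L ++ L') := by
  induction L with
  | nil =>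
    have : IsEmpty (Fin ([] : List R).length) := Fin.isEmpty
    exact ⟨LinearEquiv.uniqueProd⟩
  | cons a L ih =>
    obtain ⟨e⟩ : HasCyclicFactors ((R ⧸ Ideal.span {a}) × CyclicSum L) (a :: L) :=
      .prod_cons (.refl R _) ⟨.refl R _⟩
    exact (HasCyclicFactors.prod_cons (.refl R _) ih).of_linearEquiv
      ((e.symm.prodCongr (.refl R _)).trans (LinearEquiv.prodAssoc R _ _ _))

theorem HasCyclicFactors.prod (h : HasCyclicFactors M L) (h' : HasCyclicFactors N L') :
    HasCyclicFactors (M × N) (L ++ L') :=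
  (hasCyclicFactors_append L L').of_linearEquiv (h.some.prodCongr h'.some)

theorem hasCyclicFactors_ofFn {n : ℕ} (f : Fin n → R) :
    HasCyclicFactors (∀ i, R ⧸ Ideal.span {f i}) (List.ofFn f) := by
  induction n with
  | zero => simpa only [List.ofFn_zero] using hasCyclicFactors_nil
  | succ n ih =>
    rw [List.ofFn_succ]
    exact (HasCyclicFactors.prod_cons (.refl R _) (ih _)).of_linearEquiv
      (Fin.consLinearEquiv R fun i => R ⧸ Ideal.span {f i}).symm

theorem hasCyclicFactors_singleton (a : R) : HasCyclicFactors (R ⧸ Ideal.span {a}) [a] :=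
  (HasCyclicFactors.prod_cons (.refl R _) (hasCyclicFactors_nil (M := PUnit))).of_linearEquiv
    LinearEquiv.prodUnique.symm

end HasCyclicFactors

namespace CyclicEquiv

variable {L L₁ L₁' L₂ L₂' L₃ : List R}

theorem refl (L : List R) : CyclicEquiv L L :=
  ⟨.refl R _⟩

theorem symm (h : CyclicEquiv L₁ L₂) : CyclicEquiv L₂ L₁ :=
  HasCyclicFactors.cyclicEquiv h (refl L₁)

theorem trans (h : CyclicEquiv L₁ L₂) (h' : CyclicEquiv L₂ L₃) : CyclicEquiv L₁ L₃ :=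
  HasCyclicFactors.trans h h'

theorem append (h : CyclicEquiv L₁ L₁') (h' : CyclicEquiv L₂ L₂') :
    CyclicEquiv (L₁ ++ L₂) (L₁' ++ L₂') :=
  ((refl L₁).prod (refl L₂)).cyclicEquiv (h.prod h')

theorem cons (a : R) (h : CyclicEquiv L₁ L₂) : CyclicEquiv (a :: L₁) (a :: L₂) :=
  (refl [a]).append h

theorem of_perm (h : L₁.Perm L₂) : CyclicEquiv L₁ L₂ := by
  induction h with
  | nil => exact refl []
  | cons a _ ih => exact ih.cons a
  | swap a b L =>
    have hswap : CyclicEquiv [b, a] [a, b] := ((hasCyclicFactors_singleton b).prod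
      (hasCyclicFactors_singleton a)).cyclicEquiv (((hasCyclicFactors_singleton a).prod
        (hasCyclicFactors_singleton b)).of_linearEquiv (LinearEquiv.prodComm R _ _))
    exact hswap.append (refl L)
  | trans _ _ ih ih' => exact ih.trans ih'

theorem of_associated {a b : R} (h : Associated a b) : CyclicEquiv [a] [b] := by
  obtain ⟨u, rfl⟩ := h
  exact (hasCyclicFactors_singleton a).cyclicEquiv ((hasCyclicFactors_singleton _).of_linearEquiv
    (Submodule.quotEquivOfEq _ _ (Ideal.span_singleton_mul_right_unit u.isUnit a).symm))

theorem cons_of_isUnit {a : R} (ha : IsUnit a) (L : List R) : CyclicEquiv (a :: L) L := by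
  have : Subsingleton (R ⧸ Ideal.span {a}) :=
    Ideal.Quotient.subsingleton_iff.2 (Ideal.span_singleton_eq_top.2 ha)
  exact ((hasCyclicFactors_singleton a).cyclicEquiv hasCyclicFactors_nil).append (refl L)

theorem filter_not_isUnit [DecidablePred (IsUnit : R → Prop)] (L : List R) :
    CyclicEquiv L (L.filter (¬ IsUnit ·)) := by
  induction L with
  | nil => exact refl []
  | cons a L ih =>
    by_cases ha : IsUnit a
    · simpa [ha] using (cons_of_isUnit ha L).trans ih
    · simpa [ha] using ih.cons a

end CyclicEquiv

/-- Multiplication by `c` as a map `R/(a) → R/(b)`, where `b ∣ c * a`. -/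
def quotientMul {a b : R} (c : R) (h : b ∣ c * a) :
    (R ⧸ Ideal.span {a}) →ₗ[R] R ⧸ Ideal.span {b} :=
  Submodule.mapQ _ _ (LinearMap.mulLeft R c) <|
    (Ideal.span_singleton_le_iff_mem _).2 (Ideal.mem_span_singleton.2 h)

/- The base change of `R²` with matrix `[[-u, v], [b, a]]` and inverse `[[-a, v], [b, u]]` carries
the submodule `(d * a) ⊕ (d * b)` onto `(d) ⊕ (d * a * b)`. -/
theorem cyclicEquiv_mul_mul (d : R) {a b : R} (hab : IsCoprime a b) :
    CyclicEquiv [d * a, d * b] [d, d * a * b] := by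
  obtain ⟨u, v, h⟩ := hab
  let f₁₁ : (R ⧸ Ideal.span {d * a}) →ₗ[R] R ⧸ Ideal.span {d} :=
    quotientMul (-u) ⟨-u * a, by ring⟩
  let f₁₂ : (R ⧸ Ideal.span {d * b}) →ₗ[R] R ⧸ Ideal.span {d} := quotientMul v ⟨v * b, by ring⟩
  let f₂₁ : (R ⧸ Ideal.span {d * a}) →ₗ[R] R ⧸ Ideal.span {d * a * b} :=
    quotientMul b ⟨1, by ring⟩
  let f₂₂ : (R ⧸ Ideal.span {d * b}) →ₗ[R] R ⧸ Ideal.span {d * a * b} :=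
    quotientMul a ⟨1, by ring⟩
  let g₁₁ : (R ⧸ Ideal.span {d}) →ₗ[R] R ⧸ Ideal.span {d * a} := quotientMul (-a) ⟨-1, by ring⟩
  let g₁₂ : (R ⧸ Ideal.span {d * a * b}) →ₗ[R] R ⧸ Ideal.span {d * a} :=
    quotientMul v ⟨v * b, by ring⟩
  let g₂₁ : (R ⧸ Ideal.span {d}) →ₗ[R] R ⧸ Ideal.span {d * b} := quotientMul b ⟨1, by ring⟩
  let g₂₂ : (R ⧸ Ideal.span {d * a * b}) →ₗ[R] R ⧸ Ideal.span {d * b} :=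
    quotientMul u ⟨u * a, by ring⟩
  have e : ((R ⧸ Ideal.span {d * a}) × (R ⧸ Ideal.span {d * b})) ≃ₗ[R]
      (R ⧸ Ideal.span {d}) × (R ⧸ Ideal.span {d * a * b}) := by
    refine .ofLinearMap ((f₁₁.coprod f₁₂).prod (f₂₁.coprod f₂₂))
      ((g₁₁.coprod g₁₂).prod (g₂₁.coprod g₂₂)) (LinearMap.ext ?_) (LinearMap.ext ?_)
    all_goals
      rintro ⟨x, y⟩
      obtain ⟨x, rfl⟩ := Ideal.Quotient.mk_surjective x
      obtain ⟨y, rfl⟩ := Ideal.Quotient.mk_surjective y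
      refine Prod.ext (congrArg (Ideal.Quotient.mk _) ?_) (congrArg (Ideal.Quotient.mk _) ?_) <;>
        simp only [LinearMap.mulLeft_apply]
    · linear_combination x * h
    · linear_combination y * h
    · linear_combination x * h
    · linear_combination y * h
  exact ((hasCyclicFactors_singleton _).prod (hasCyclicFactors_singleton _)).cyclicEquiv
    (((hasCyclicFactors_singleton _).prod (hasCyclicFactors_singleton _)).of_linearEquiv e)

end CyclicSum

section DvdChain

variable {α : Type*} [CommMonoidWithZero α]

section GcdInsert

variable [GCDMonoid α]

/-- Inserts `a` into a list, replacing each member `b` in turn by the greatest common divisor of `b`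
and the element carried along, and carrying along their least common multiple. Inserting into a
divisibility chain gives a divisibility chain. -/
def gcdInsert (a : α) : List α → List α
  | [] => [a]
  | b :: L => gcd a b :: gcdInsert (lcm a b) L

theorem forall_mem_gcdInsert {p : α → Prop} (hgcd : ∀ a b, p a → p b → p (gcd a b))
    (hlcm : ∀ a b, p a → p b → p (lcm a b)) {a : α} {L : List α} (ha : p a)
    (hL : ∀ b ∈ L, p b) : ∀ b ∈ gcdInsert a L, p b := by
  induction L generalizing a with
  | nil => simpa [gcdInsert] using ha
  | cons b L ih =>
    rw [List.forall_mem_cons] at hL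
    exact List.forall_mem_cons.2 ⟨hgcd a b ha hL.1, ih (hlcm a b ha hL.1) hL.2⟩

theorem pairwise_dvd_gcdInsert (a : α) {L : List α} (hL : L.Pairwise (· ∣ ·)) :
    (gcdInsert a L).Pairwise (· ∣ ·) := by
  induction L generalizing a with
  | nil => exact List.pairwise_singleton _ a
  | cons b L ih =>
    rw [List.pairwise_cons] at hL
    have hdvd : ∀ c ∈ gcdInsert (lcm a b) L, gcd a b ∣ c :=
      forall_mem_gcdInsert (p := (gcd a b ∣ ·)) (fun _ _ => dvd_gcd)
        (fun c d hc _ => hc.trans (dvd_lcm_left c d))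
        ((gcd_dvd_left a b).trans (dvd_lcm_left a b))
        fun c hc => (gcd_dvd_right a b).trans (hL.1 c hc)
    exact List.pairwise_cons.2 ⟨hdvd, ih (lcm a b) hL.2⟩

theorem pairwise_dvd_foldr_gcdInsert (L : List α) :
    (L.foldr gcdInsert []).Pairwise (· ∣ ·) := by
  induction L with
  | nil => exact .nil
  | cons a L ih => exact pairwise_dvd_gcdInsert a ih

theorem forall_mem_foldr_gcdInsert {p : α → Prop} (hgcd : ∀ a b, p a → p b → p (gcd a b))
    (hlcm : ∀ a b, p a → p b → p (lcm a b)) {L : List α} (hL : ∀ b ∈ L, p b) :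
    ∀ b ∈ L.foldr gcdInsert [], p b := by
  induction L with
  | nil => exact hL
  | cons a L ih =>
    rw [List.forall_mem_cons] at hL
    exact forall_mem_gcdInsert hgcd hlcm hL.1 (ih hL.2)

end GcdInsert

/-- `L` is a divisibility chain of nonzero nonunits, each normalized in its class of associates:
the shape of the list of invariant factors of a finitely generated torsion module over a principal
ideal domain. -/
structure IsInvariantFactorChain [NormalizationMonoid α] (L : List α) : Prop where
  ne_zero : ∀ a ∈ L, a ≠ 0
  normalize_eq : ∀ a ∈ L, normalize a = a
  not_isUnit : ∀ a ∈ L, ¬ IsUnit a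
  pairwise_dvd : L.Pairwise (· ∣ ·)

theorem IsInvariantFactorChain.of_cons [NormalizationMonoid α] {a : α} {L : List α}
    (h : IsInvariantFactorChain (a :: L)) : IsInvariantFactorChain L where
  ne_zero b hb := h.ne_zero b (.tail a hb)
  normalize_eq b hb := h.normalize_eq b (.tail a hb)
  not_isUnit b hb := h.not_isUnit b (.tail a hb)
  pairwise_dvd := h.pairwise_dvd.of_cons

section GcdLcm

variable {a b : α} {L : List α}

theorem pairwise_dvd_map_gcd_append_map_lcm [GCDMonoid α] (a : α) (hL : L.Pairwise (· ∣ ·)) :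
    (L.map (gcd a) ++ L.map (lcm a)).Pairwise (· ∣ ·) := by
  refine List.pairwise_append.2 ⟨hL.map _ fun b c h => gcd_dvd_gcd dvd_rfl h,
    hL.map _ fun b c h => lcm_dvd_lcm dvd_rfl h, ?_⟩
  simp only [List.mem_map]
  rintro _ ⟨b, -, rfl⟩ _ ⟨c, -, rfl⟩
  exact (gcd_dvd_left a b).trans (dvd_lcm_left a c)

variable [DecidablePred (IsUnit : α → Prop)]

theorem IsInvariantFactorChain.filter_map_gcd_append_map_lcm [NormalizedGCDMonoid α]
    (hL : IsInvariantFactorChain L) (ha : a ≠ 0) :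
    IsInvariantFactorChain ((L.map (gcd a) ++ L.map (lcm a)).filter (¬ IsUnit ·)) where
  ne_zero b hb := by
    simp only [List.mem_filter, List.mem_append, List.mem_map] at hb
    obtain ⟨⟨b, -, rfl⟩ | ⟨b, hb, rfl⟩, -⟩ := hb
    · exact gcd_ne_zero_of_left ha
    · exact lcm_ne_zero_iff.2 ⟨ha, hL.ne_zero b hb⟩
  normalize_eq b hb := by
    simp only [List.mem_filter, List.mem_append, List.mem_map] at hb
    obtain ⟨⟨b, -, rfl⟩ | ⟨b, -, rfl⟩, -⟩ := hb
    · exact normalize_gcd a b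
    · exact normalize_lcm a b
  not_isUnit b hb := of_decide_eq_true (List.mem_filter.1 hb).2
  pairwise_dvd := (pairwise_dvd_map_gcd_append_map_lcm a hL.pairwise_dvd).filter _

theorem dvd_of_mem_filter_map_gcd_append_map_lcm [GCDMonoid α] (ha : Irreducible a)
    (hb : b ∈ (L.map (gcd a) ++ L.map (lcm a)).filter (¬ IsUnit ·)) : a ∣ b := by
  simp only [List.mem_filter, List.mem_append, List.mem_map, decide_eq_true_eq] at hb
  obtain ⟨⟨b, -, rfl⟩ | ⟨b, -, rfl⟩, hunit⟩ := hb
  · rw [ha.isUnit_gcd_iff, not_not] at hunit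
    exact dvd_gcd dvd_rfl hunit
  · exact dvd_lcm_left a b

end GcdLcm

theorem countP_not_dvd_eq_length_iff {a : α} {L : List α} (h : (a :: L).Pairwise (· ∣ ·)) (x : α)
    [DecidablePred fun a : α => a ∣ x] :
    (a :: L).countP (¬ · ∣ x) = (a :: L).length ↔ ¬ a ∣ x := by
  simp only [List.countP_eq_length, List.forall_mem_cons, decide_eq_true_eq, and_iff_left_iff_imp]
  exact fun ha b hb hbx => ha ((List.rel_of_pairwise_cons h hb).trans hbx)

theorem IsInvariantFactorChain.eq_of_countP_not_dvd_eq [IsCancelMulZero α] [NormalizationMonoid α]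
    [DecidableRel ((· ∣ ·) : α → α → Prop)] {L L' : List α} (hL : IsInvariantFactorChain L)
    (hL' : IsInvariantFactorChain L') (h : ∀ x : α, L.countP (¬ · ∣ x) = L'.countP (¬ · ∣ x)) :
    L = L' := by
  have countP_one : ∀ {L : List α}, IsInvariantFactorChain L → L.countP (¬ · ∣ 1) = L.length :=
    fun hL => List.countP_eq_length.2 fun a ha =>
      decide_eq_true fun h1 => hL.not_isUnit a ha (isUnit_of_dvd_one h1)
  have hlength : L.length = L'.length := by rw [← countP_one hL, h, countP_one hL']
  induction L generalizing L' with
  | nil => exact (List.length_eq_zero_iff.1 hlength.symm).symm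
  | cons a L ih =>
    cases L' with
    | nil => simp at hlength
    | cons a' L' =>
      have hdvd : ∀ x, a ∣ x ↔ a' ∣ x := fun x => not_iff_not.1 <| by
        rw [← countP_not_dvd_eq_length_iff hL.pairwise_dvd,
          ← countP_not_dvd_eq_length_iff hL'.pairwise_dvd, h, hlength]
      obtain rfl : a = a' := dvd_antisymm_of_normalize_eq (hL.normalize_eq a (by simp))
        (hL'.normalize_eq a' (by simp)) ((hdvd a').2 dvd_rfl) ((hdvd a).1 dvd_rfl)
      have htail : ∀ x : α, L.countP (¬ · ∣ x) = L'.countP (¬ · ∣ x) := by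
        simpa only [List.countP_cons, Nat.add_right_cancel_iff] using h
      rw [ih hL.of_cons hL'.of_cons htail (Nat.succ.inj hlength)]

end DvdChain

section Existence

variable {R : Type*} [CommRing R]

theorem CyclicEquiv.map_normalize [NormalizationMonoid R] (L : List R) :
    CyclicEquiv L (L.map normalize) := by
  induction L with
  | nil => exact refl []
  | cons a L ih => exact (of_associated (associated_normalize a)).append ih

variable [IsDomain R]

namespace CyclicEquiv

variable [IsBezout R] [GCDMonoid R]

theorem gcd_lcm (a b : R) : CyclicEquiv [a, b] [gcd a b, lcm a b] := by
  obtain ⟨a', b', ha, hb, hunit⟩ := extract_gcd a b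
  generalize gcd a b = d at ha hb ⊢
  have hcoprime : IsCoprime a' b' := (gcd_isUnit_iff a' b').1 hunit
  have hlcm : Associated (d * a' * b') (lcm a b) := by
    refine associated_of_dvd_dvd ?_ (lcm_dvd ⟨b', by rw [ha]⟩ ⟨a', by rw [hb]; ring⟩)
    have hb' : d * a' * b' ∣ a' * lcm a b := by
      rw [mul_assoc, mul_left_comm, ← hb]
      exact mul_dvd_mul_left a' (dvd_lcm_right a b)
    have ha' : d * a' * b' ∣ b' * lcm a b := by
      rw [← ha, mul_comm]
      exact mul_dvd_mul_left b' (dvd_lcm_left a b)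
    obtain ⟨u, v, huv⟩ := hcoprime
    have hsplit : lcm a b = u * (a' * lcm a b) + v * (b' * lcm a b) := by
      linear_combination -lcm a b * huv
    rw [hsplit]
    exact dvd_add (hb'.mul_left u) (ha'.mul_left v)
  nth_rewrite 1 [ha, hb]
  exact (cyclicEquiv_mul_mul d hcoprime).trans ((of_associated hlcm).cons d)

theorem gcdInsert (a : R) (L : List R) : CyclicEquiv (a :: L) (StableGL.gcdInsert a L) := by
  induction L generalizing a with
  | nil => exact refl [a]
  | cons b L ih => exact ((gcd_lcm a b).append (refl L)).trans ((ih (lcm a b)).cons (gcd a b))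

theorem foldr_gcdInsert (L : List R) : CyclicEquiv L (L.foldr StableGL.gcdInsert []) := by
  induction L with
  | nil => exact refl []
  | cons a L ih => exact (ih.cons a).trans (CyclicEquiv.gcdInsert a _)

theorem replicate_append (a : R) (L : List R) :
    CyclicEquiv (List.replicate L.length a ++ L) (L.map (gcd a) ++ L.map (lcm a)) := by
  induction L with
  | nil => exact refl []
  | cons b L ih =>
    have hperm : (List.replicate (b :: L).length a ++ b :: L).Perm
        ([a, b] ++ (List.replicate L.length a ++ L)) :=
      List.perm_middle.cons a
    have hperm' : ([gcd a b, lcm a b] ++ (L.map (gcd a) ++ L.map (lcm a))).Perm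
        ((b :: L).map (gcd a) ++ (b :: L).map (lcm a)) :=
      (List.perm_middle (l₁ := L.map (gcd a))).symm.cons (gcd a b)
    exact (of_perm hperm).trans (((gcd_lcm a b).append ih).trans (of_perm hperm'))

end CyclicEquiv

theorem exists_cyclicEquiv_isInvariantFactorChain [IsBezout R] [NormalizedGCDMonoid R]
    {L : List R} (hL : ∀ a ∈ L, a ≠ 0) :
    ∃ L', IsInvariantFactorChain L' ∧ CyclicEquiv L L' := by
  classical
  let C := (L.map normalize).foldr gcdInsert []
  have hC : ∀ a ∈ C, a ≠ 0 ∧ normalize a = a := by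
    refine forall_mem_foldr_gcdInsert (p := fun a => a ≠ 0 ∧ normalize a = a)
      (fun a b ha _ => ⟨fun h => ha.1 ((gcd_eq_zero_iff a b).1 h).1, normalize_gcd a b⟩)
      (fun a b ha hb => ⟨lcm_ne_zero_iff.2 ⟨ha.1, hb.1⟩, normalize_lcm a b⟩) ?_
    simpa using hL
  refine ⟨C.filter (¬ IsUnit ·), ⟨fun a ha => (hC a (List.mem_of_mem_filter ha)).1,
    fun a ha => (hC a (List.mem_of_mem_filter ha)).2,
    fun a ha => by simpa using List.of_mem_filter ha,
    (pairwise_dvd_foldr_gcdInsert _).filter _⟩, ?_⟩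
  exact ((CyclicEquiv.map_normalize L).trans (.foldr_gcdInsert _)).trans (.filter_not_isUnit C)

theorem exists_hasCyclicFactors_of_isTorsion [IsPrincipalIdealRing R] {M : Type*}
    [AddCommGroup M] [Module R M] [Module.Finite R M] (hM : Module.IsTorsion R M) :
    ∃ L : List R, (∀ a ∈ L, a ≠ 0) ∧ HasCyclicFactors M L := by
  obtain ⟨ι, _, p, hp, k, ⟨e⟩⟩ := Module.equiv_directSum_of_isTorsion hM
  classical
  let enum : Fin (Fintype.card ι) ≃ ι := (Fintype.equivFin ι).symm
  let f : Fin (Fintype.card ι) → R := fun i => p (enum i) ^ k (enum i)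
  refine ⟨List.ofFn f, ?_, (hasCyclicFactors_ofFn f).of_linearEquiv ?_⟩
  · rw [List.forall_mem_ofFn_iff]
    exact fun i => pow_ne_zero _ (hp (enum i)).ne_zero
  · exact (e.trans (DirectSum.linearEquivFunOnFintype R ι _)).trans
      (LinearEquiv.piCongrLeft R (fun i => R ⧸ R ∙ p i ^ k i) enum).symm

end Existence

section NotMemCount

variable {R : Type*} [CommRing R] {ι κ : Type*} [Fintype κ]

theorem card_le_card_of_mul_sub_one_mem [Fintype ι] [DecidableEq ι] {I : Ideal R} (hI : I ≠ ⊤)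
    (A : Matrix ι κ R) (B : Matrix κ ι R)
    (h : ∀ i l, (A * B) i l - (1 : Matrix ι ι R) i l ∈ I) : Fintype.card ι ≤ Fintype.card κ := by
  have : Nontrivial (R ⧸ I) := Ideal.Quotient.nontrivial_iff.2 hI
  let φ := Ideal.Quotient.mk I
  have hone : A.map φ * B.map φ = 1 := by
    rw [← Matrix.map_mul, ← Matrix.map_one φ (map_zero φ) (map_one φ)]
    exact Matrix.ext fun i l => Ideal.Quotient.eq.2 (h i l)
  calc Fintype.card ι = (A.map φ * B.map φ).rank := by rw [hone, Matrix.rank_one]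
    _ ≤ (A.map φ).rank := Matrix.rank_mul_le_left _ _
    _ ≤ Fintype.card κ := Matrix.rank_le_card_width _

theorem smul_map_mk_eq_sum {M : Type*} [AddCommGroup M] [Module R M] [DecidableEq κ]
    {J : κ → Ideal R} (g : (∀ j, R ⧸ J j) →ₗ[R] M) (a : κ → R) (x : R) [DecidablePred (x ∉ J ·)] :
    x • g (fun j => Ideal.Quotient.mk (J j) (a j)) =
      ∑ j : {j // x ∉ J j}, (x * a j) • g (Pi.single j.1 1) := by
  have hsum : (fun j => Ideal.Quotient.mk (J j) (a j)) =
      ∑ j, a j • (Pi.single j 1 : ∀ j, R ⧸ J j) := by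
    simp_rw [← Pi.single_smul, Algebra.smul_def, mul_one]
    exact (Finset.univ_sum_single _).symm
  have hzero : ∀ j, x ∈ J j → (x * a j) • (Pi.single j 1 : ∀ j, R ⧸ J j) = 0 := by
    intro j hj
    rw [← Pi.single_smul, Algebra.smul_def, mul_one, Pi.single_eq_zero_iff]
    exact Ideal.Quotient.eq_zero_iff_mem.2 ((J j).mul_mem_right _ hj)
  rw [hsum, map_sum, Finset.smul_sum]
  simp_rw [map_smul, smul_smul]
  refine (Fintype.sum_of_injective Subtype.val Subtype.val_injective _ _ (fun j hj => ?_)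
    fun _ => rfl).symm
  have hxj : x ∈ J j := by simpa using hj
  rw [← map_smul, hzero j hxj, map_zero]

theorem sum_mul_sub_one_mem_colon [DecidableEq ι] [DecidableEq κ] {I : ι → Ideal R}
    {J : κ → Ideal R} {f : (∀ i, R ⧸ I i) →ₗ[R] ∀ j, R ⧸ J j}
    {g : (∀ j, R ⧸ J j) →ₗ[R] ∀ i, R ⧸ I i} (hgf : g ∘ₗ f = .id) {A : Matrix ι κ R}
    {B : Matrix κ ι R} (hA : ∀ i j, Ideal.Quotient.mk (J j) (A i j) = f (Pi.single i 1) j)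
    (hB : ∀ j l, Ideal.Quotient.mk (I l) (B j l) = g (Pi.single j 1) l) (x : R)
    [DecidablePred (x ∉ J ·)] (i l : ι) :
    ∑ j : {j // x ∉ J j}, A i j * B j l - (1 : Matrix ι ι R) i l ∈ (I l).colon {x} := by
  have hone : (Pi.single i 1 : ∀ i, R ⧸ I i) l =
      Ideal.Quotient.mk (I l) ((1 : Matrix ι ι R) i l) := by
    obtain rfl | hil := eq_or_ne i l
    · simp
    · simp [hil]
  rw [Submodule.mem_colon_singleton, smul_eq_mul, mul_comm, mul_sub, ← Ideal.Quotient.eq]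
  calc Ideal.Quotient.mk (I l) (x * ∑ j : {j // x ∉ J j}, A i j * B j l)
      = (∑ j : {j // x ∉ J j}, (x * A i j) • g (Pi.single j.1 1)) l := by
        simp only [Finset.mul_sum, map_sum, Finset.sum_apply, Pi.smul_apply, ← hB, ← mul_assoc]
        rfl
    _ = (x • g (f (Pi.single i 1))) l := by rw [← smul_map_mk_eq_sum, funext (hA i)]
    _ = x • (Pi.single i 1 : ∀ i, R ⧸ I i) l := by
        rw [← LinearMap.comp_apply, hgf, LinearMap.id_apply, Pi.smul_apply]
    _ = Ideal.Quotient.mk (I l) (x * (1 : Matrix ι ι R) i l) := by rw [hone]; rfl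

/- The ideals `I i : x` with `x ∉ I i` are proper and totally ordered, so the matrices of `f` and
`g` restricted to the indices with `x ∉ I i` and `x ∉ J j` become one-sided inverses of each other
modulo the largest of them. -/
theorem card_notMem_le_card_notMem [Fintype ι] {I : ι → Ideal R} {J : κ → Ideal R}
    (hI : ∀ i l, I i ≤ I l ∨ I l ≤ I i) {f : (∀ i, R ⧸ I i) →ₗ[R] ∀ j, R ⧸ J j}
    {g : (∀ j, R ⧸ J j) →ₗ[R] ∀ i, R ⧸ I i} (hgf : g ∘ₗ f = .id) (x : R)
    [DecidablePred (x ∉ I ·)] [DecidablePred (x ∉ J ·)] :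
    Fintype.card {i // x ∉ I i} ≤ Fintype.card {j // x ∉ J j} := by
  classical
  obtain _ | _ := isEmpty_or_nonempty {i // x ∉ I i}
  · simp
  obtain ⟨l₀, hl₀⟩ : ∃ l₀ : {i // x ∉ I i}, ∀ l : {i // x ∉ I i}, I l ≤ I l₀ :=
    Directed.finite_le (r := (· ≤ ·)) (f := fun l : {i // x ∉ I i} => I l)
      (fun i l => (hI i l).elim (fun h => ⟨l, h, le_rfl⟩) fun h => ⟨i, le_rfl, h⟩) id
  choose A hA using fun i j => Ideal.Quotient.mk_surjective (f (Pi.single i 1) j)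
  choose B hB using fun j l => Ideal.Quotient.mk_surjective (g (Pi.single j 1) l)
  have hproper : (I l₀).colon {x} ≠ ⊤ := by simpa using l₀.2
  refine card_le_card_of_mul_sub_one_mem hproper (.of fun i j => A i.1 j.1)
    (.of fun j l => B j.1 l.1) fun i l => Submodule.colon_mono (hl₀ l) subset_rfl ?_
  rw [← Matrix.submatrix_one _ Subtype.val_injective]
  exact sum_mul_sub_one_mem_colon hgf hA hB x i.1 l.1

end NotMemCount

section Uniqueness

variable {R : Type*} [CommRing R]

theorem card_filter_get_eq_countP {α : Type*} (p : α → Prop) [DecidablePred p] (L : List α) :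
    (Finset.univ.filter fun i : Fin L.length => p (L.get i)).card = L.countP p := by
  induction L with
  | nil => rfl
  | cons a L ih =>
    refine (Fin.card_filter_univ_succ fun i : Fin (L.length + 1) => p ((a :: L).get i)).trans ?_
    simp only [List.countP_cons, ← ih, decide_eq_true_eq, List.get_cons_zero, List.get_cons_succ']
    split_ifs <;> rfl

theorem CyclicEquiv.countP_not_dvd_le {L L' : List R} (h : CyclicEquiv L L')
    (hL : L.Pairwise (· ∣ ·)) (x : R) [DecidablePred fun a : R => a ∣ x] :
    L.countP (¬ · ∣ x) ≤ L'.countP (¬ · ∣ x) := by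
  classical
  obtain ⟨e⟩ := h
  have htotal : ∀ i l, Ideal.span {L.get i} ≤ Ideal.span {L.get l} ∨
      Ideal.span {L.get l} ≤ Ideal.span {L.get i} := by
    intro i l
    simp only [Ideal.span_singleton_le_span_singleton]
    obtain h | rfl | h := lt_trichotomy i l
    · exact .inr (List.pairwise_iff_get.1 hL i l h)
    · exact .inl dvd_rfl
    · exact .inl (List.pairwise_iff_get.1 hL l i h)
  have hcard := card_notMem_le_card_notMem htotal (LinearEquiv.symm_comp e) x
  simpa only [Fintype.card_subtype, Ideal.mem_span_singleton,
    card_filter_get_eq_countP (¬ · ∣ x)] using hcard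

theorem CyclicEquiv.countP_not_dvd_eq {L L' : List R} (h : CyclicEquiv L L')
    (hL : L.Pairwise (· ∣ ·)) (hL' : L'.Pairwise (· ∣ ·)) (x : R)
    [DecidablePred fun a : R => a ∣ x] : L.countP (¬ · ∣ x) = L'.countP (¬ · ∣ x) :=
  (h.countP_not_dvd_le hL x).antisymm (h.symm.countP_not_dvd_le hL' x)

theorem existsUnique_isInvariantFactorChain [IsDomain R] [IsPrincipalIdealRing R]
    [NormalizedGCDMonoid R] {M : Type*} [AddCommGroup M] [Module R M] [Module.Finite R M]
    (hM : Module.IsTorsion R M) :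
    ∃! L : List R, IsInvariantFactorChain L ∧ HasCyclicFactors M L := by
  classical
  obtain ⟨L, hL, hML⟩ := exists_hasCyclicFactors_of_isTorsion hM
  obtain ⟨L', hL', hLL'⟩ := exists_cyclicEquiv_isInvariantFactorChain hL
  refine ⟨L', ⟨hL', hML.trans hLL'⟩, fun L'' h => h.1.eq_of_countP_not_dvd_eq hL' fun x => ?_⟩
  exact (h.2.cyclicEquiv (hML.trans hLL')).countP_not_dvd_eq h.1.pairwise_dvd hL'.pairwise_dvd x

end Uniqueness

section MatrixModule

variable {K : Type*} [Field K]

theorem nonempty_aeval_linearEquiv_iff {R V W : Type*} [CommRing R] [AddCommGroup V] [Module R V]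
    [AddCommGroup W] [Module R W] {f : Module.End R V} {g : Module.End R W} :
    Nonempty (Module.AEval' f ≃ₗ[R[X]] Module.AEval' g) ↔
      ∃ e : V ≃ₗ[R] W, ∀ v, e (f v) = g (e v) := by
  constructor
  · rintro ⟨e⟩
    refine ⟨(Module.AEval'.of f).trans
      ((e.restrictScalars R).trans (Module.AEval'.of g).symm), fun v => ?_⟩
    simp only [LinearEquiv.trans_apply, LinearEquiv.restrictScalars_apply]
    rw [← Module.AEval'.X_smul_of, map_smul, Module.AEval'.of_symm_X_smul]
  · rintro ⟨e, he⟩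
    refine ⟨LinearEquiv.ofAEval _ (e.trans (Module.AEval'.of g)) fun v => ?_⟩
    rw [LinearEquiv.trans_apply, LinearEquiv.trans_apply, Module.AEval'.X_smul_of, ← he]
    rfl

/-- The `K[X]`-module `Kⁿ` on which `X` acts by the matrix `σ`; matrices are similar exactly when
these modules are isomorphic. -/
abbrev MatrixModule {n : ℕ} (σ : Matrix (Fin n) (Fin n) K) : Type _ :=
  Module.AEval' (Matrix.toLin' σ)

variable {m n : ℕ}

theorem similar_iff_exists_linearEquiv {σ τ : Matrix (Fin n) (Fin n) K} :
    Similar σ τ ↔ ∃ e : (Fin n → K) ≃ₗ[K] (Fin n → K),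
      ∀ v, e (Matrix.toLin' σ v) = Matrix.toLin' τ (e v) := by
  constructor
  · rintro ⟨ρ, rfl⟩
    refine ⟨Matrix.toLin'OfInv (M := ρ.val) (M' := ρ⁻¹.val) ρ.mul_inv ρ.inv_mul, fun v => ?_⟩
    simp [Matrix.toLin'OfInv, ← mul_assoc]
  · rintro ⟨e, he⟩
    refine ⟨⟨e.symm.toMatrix', e.toMatrix', ?_, ?_⟩, Matrix.toLin'.injective ?_⟩
    · simp [← LinearMap.toMatrix'_comp]
    · simp [← LinearMap.toMatrix'_comp]
    · refine LinearMap.ext fun v => ?_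
      simp [← he]

theorem similar_iff_nonempty_linearEquiv {σ τ : Matrix (Fin n) (Fin n) K} :
    Similar σ τ ↔ Nonempty (MatrixModule σ ≃ₗ[K[X]] MatrixModule τ) :=
  similar_iff_exists_linearEquiv.trans nonempty_aeval_linearEquiv_iff.symm

theorem Similar.symm {σ τ : Matrix (Fin n) (Fin n) K} (h : Similar σ τ) : Similar τ σ :=
  similar_iff_nonempty_linearEquiv.2 ((similar_iff_nonempty_linearEquiv.1 h).map .symm)

theorem Similar.trans {ρ σ τ : Matrix (Fin n) (Fin n) K} (h : Similar ρ σ) (h' : Similar σ τ) :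
    Similar ρ τ :=
  similar_iff_nonempty_linearEquiv.2 ⟨(similar_iff_nonempty_linearEquiv.1 h).some.trans
    (similar_iff_nonempty_linearEquiv.1 h').some⟩

theorem leftMulMatrix_root {P : K[X]} (hP : P.Monic) :
    Algebra.leftMulMatrix (AdjoinRoot.powerBasis' hP).basis (AdjoinRoot.root P) = companion P := by
  have hmin : minpoly K (AdjoinRoot.root P) = P := by
    rw [AdjoinRoot.minpoly_root hP.ne_zero, hP.leadingCoeff, inv_one, C_1, mul_one]
  refine (AdjoinRoot.powerBasis' hP).leftMulMatrix.trans ?_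
  rw [PowerBasis.minpolyGen_eq, AdjoinRoot.powerBasis'_gen, hmin]
  rfl

theorem nonempty_matrixModule_companion_linearEquiv {P : K[X]} (hP : P.Monic) :
    Nonempty (MatrixModule (companion P) ≃ₗ[K[X]] K[X] ⧸ Ideal.span {P}) := by
  let b := (AdjoinRoot.powerBasis' hP).basis
  let e : (Fin P.natDegree → K) ≃ₗ[K] K[X] ⧸ Ideal.span {P} := b.equivFun.symm
  refine ⟨LinearEquiv.ofAEval _ e fun v => b.equivFun.symm_apply_eq.2 ?_⟩
  have h := Algebra.leftMulMatrix_mulVec_repr b (AdjoinRoot.root P) (b.equivFun.symm v)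
  rw [leftMulMatrix_root hP] at h
  exact (congrArg (companion P).mulVec (b.equivFun.apply_symm_apply v).symm).trans h

theorem nonempty_aeval_prodMap_linearEquiv {R V W : Type*} [CommRing R] [AddCommGroup V]
    [Module R V] [AddCommGroup W] [Module R W] (f : Module.End R V) (g : Module.End R W) :
    Nonempty (Module.AEval' (f.prodMap g) ≃ₗ[R[X]] Module.AEval' f × Module.AEval' g) :=
  ⟨LinearEquiv.ofAEval _ ((Module.AEval'.of f).prodCongr (Module.AEval'.of g)) fun v =>
    Prod.ext (Module.AEval'.X_smul_of f v.1).symm (Module.AEval'.X_smul_of g v.2).symm⟩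

theorem nonempty_matrixModule_directSum_linearEquiv (σ : Matrix (Fin m) (Fin m) K)
    (τ : Matrix (Fin n) (Fin n) K) :
    Nonempty (MatrixModule (directSum σ τ) ≃ₗ[K[X]] MatrixModule σ × MatrixModule τ) := by
  let e : (Fin (m + n) → K) ≃ₗ[K] (Fin m → K) × (Fin n → K) :=
    (LinearEquiv.funCongrLeft K K finSumFinEquiv).trans
      (LinearEquiv.sumArrowLequivProdArrow (Fin m) (Fin n) K K)
  have he (v) : e (Matrix.toLin' (directSum σ τ) v) =
      (Matrix.toLin' σ).prodMap (Matrix.toLin' τ) (e v) := by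
    have hv : v ∘ finSumFinEquiv = Sum.elim (e v).1 (e v).2 := (Sum.elim_comp_inl_inr _).symm
    rw [directSum, Matrix.reindex_apply, Matrix.toLin'_apply, Matrix.submatrix_mulVec_equiv,
      Equiv.symm_symm, hv, Matrix.fromBlocks_mulVec]
    simp only [Matrix.zero_mulVec, add_zero, zero_add]
    ext i <;> simp [e]
  exact ⟨(nonempty_aeval_linearEquiv_iff.2 ⟨e, he⟩).some.trans
    (nonempty_aeval_prodMap_linearEquiv _ _).some⟩

theorem HasCyclicFactors.castSize {σ : Matrix (Fin m) (Fin m) K} {L : List K[X]}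
    (hσ : HasCyclicFactors (MatrixModule σ) L) (h : m = n) :
    HasCyclicFactors (MatrixModule (castSize h σ)) L := by
  subst h
  exact hσ

theorem HasCyclicFactors.of_similar {σ τ : Matrix (Fin n) (Fin n) K} {L : List K[X]}
    (hs : Similar σ τ) (h : HasCyclicFactors (MatrixModule τ) L) :
    HasCyclicFactors (MatrixModule σ) L :=
  h.of_linearEquiv (similar_iff_nonempty_linearEquiv.1 hs).some

theorem HasCyclicFactors.similar {σ τ : Matrix (Fin n) (Fin n) K} {L : List K[X]}
    (hσ : HasCyclicFactors (MatrixModule σ) L) (hτ : HasCyclicFactors (MatrixModule τ) L) :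
    Similar σ τ :=
  similar_iff_nonempty_linearEquiv.2 (hσ.nonempty_linearEquiv hτ)

theorem hasCyclicFactors_companionSum {L : List K[X]} (hL : ∀ P ∈ L, P.Monic) :
    HasCyclicFactors (MatrixModule (companionSum L)) L := by
  induction L with
  | nil =>
    have : Subsingleton (MatrixModule (companionSum ([] : List K[X]))) :=
      inferInstanceAs (Subsingleton (Fin 0 → K))
    exact hasCyclicFactors_nil
  | cons P L ih =>
    obtain ⟨hP, hL⟩ := List.forall_mem_cons.1 hL
    obtain ⟨e⟩ := nonempty_matrixModule_companion_linearEquiv hP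
    obtain ⟨e'⟩ := nonempty_matrixModule_directSum_linearEquiv (companion P) (companionSum L)
    exact ((HasCyclicFactors.prod_cons e (ih hL)).of_linearEquiv e').castSize _

theorem eq_of_matrixModule_linearEquiv {σ : Matrix (Fin m) (Fin m) K}
    {τ : Matrix (Fin n) (Fin n) K} (e : MatrixModule σ ≃ₗ[K[X]] MatrixModule τ) : m = n := by
  obtain ⟨e, -⟩ := nonempty_aeval_linearEquiv_iff.1 ⟨e⟩
  simpa only [Module.finrank_fin_fun] using e.finrank_eq

theorem hasCyclicFactors_iff_similar {σ : Matrix (Fin n) (Fin n) K} {L : List K[X]}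
    (hL : ∀ P ∈ L, P.Monic) :
    HasCyclicFactors (MatrixModule σ) L ↔
      ∃ h : (L.map natDegree).sum = n, Similar σ (StableGL.castSize h (companionSum L)) := by
  have hsum := hasCyclicFactors_companionSum hL
  constructor
  · intro hσ
    have h := eq_of_matrixModule_linearEquiv (hsum.nonempty_linearEquiv hσ).some
    exact ⟨h, hσ.similar (hsum.castSize h)⟩
  · rintro ⟨h, hs⟩
    exact (hsum.castSize h).of_similar hs

open Classical in
theorem isInvariantFactorChain_iff {L : List K[X]} :
    IsInvariantFactorChain L ↔
      (∀ P ∈ L, P.Monic) ∧ (∀ P ∈ L, 0 < P.natDegree) ∧ L.IsChain (· ∣ ·) := by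
  rw [List.isChain_iff_pairwise]
  constructor
  · intro h
    have hmonic : ∀ P ∈ L, P.Monic := fun P hP =>
      h.normalize_eq P hP ▸ monic_normalize (h.ne_zero P hP)
    exact ⟨hmonic, fun P hP => (hmonic P hP).natDegree_pos_of_not_isUnit (h.not_isUnit P hP),
      h.pairwise_dvd⟩
  · rintro ⟨hmonic, hpos, hdvd⟩
    exact ⟨fun P hP => (hmonic P hP).ne_zero, fun P hP => (hmonic P hP).normalize_eq_self,
      fun P hP => not_isUnit_of_natDegree_pos P (hpos P hP), hdvd⟩

open Classical in
theorem isInvariantFactors_iff {σ : Matrix (Fin n) (Fin n) K} {L : List K[X]} :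
    IsInvariantFactors σ L ↔
      IsInvariantFactorChain L ∧ HasCyclicFactors (MatrixModule σ) L := by
  rw [isInvariantFactorChain_iff]
  constructor
  · intro h
    exact ⟨⟨h.monic, h.nonconstant, h.chain⟩, (hasCyclicFactors_iff_similar h.monic).2 h.similar⟩
  · rintro ⟨⟨hmonic, hpos, hchain⟩, hσ⟩
    exact ⟨hmonic, hpos, hchain, (hasCyclicFactors_iff_similar hmonic).1 hσ⟩

open Classical in
theorem existsUnique_isInvariantFactors (σ : Matrix (Fin n) (Fin n) K) :
    ∃! L : List K[X], IsInvariantFactors σ L := by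
  simp only [isInvariantFactors_iff]
  exact existsUnique_isInvariantFactorChain
    (Module.AEval.isTorsion_of_finiteDimensional K (Fin n → K) (Matrix.toLin' σ))

end MatrixModule

section FrobeniusForm

variable {K : Type*} [Field K] {n : ℕ}

theorem IsInvariantFactors.of_similar {σ τ : Matrix (Fin n) (Fin n) K} {L : List K[X]}
    (hs : Similar σ τ) (h : IsInvariantFactors τ L) : IsInvariantFactors σ L :=
  { h with similar := h.similar.imp fun _ => hs.trans }

theorem IsInvariantFactors.frobeniusForm_eq {σ : Matrix (Fin n) (Fin n) K} {L : List K[X]}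
    (h : IsInvariantFactors σ L) (hn : (L.map natDegree).sum = n) :
    frobeniusForm σ = castSize hn (companionSum L) := by
  have hex : ∃ L : List K[X], IsInvariantFactors σ L := ⟨L, h⟩
  obtain rfl : hex.choose = L := (existsUnique_isInvariantFactors σ).unique hex.choose_spec h
  exact dif_pos hex

theorem similar_iff_frobeniusForm_eq {σ τ : Matrix (Fin n) (Fin n) K} :
    Similar σ τ ↔ frobeniusForm σ = frobeniusForm τ := by
  constructor
  · intro h
    obtain ⟨L, hL, -⟩ := existsUnique_isInvariantFactors τ
    obtain ⟨hn, -⟩ := hL.similar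
    rw [(hL.of_similar h).frobeniusForm_eq hn, hL.frobeniusForm_eq hn]
  · intro h
    exact (similar_frobeniusForm σ).trans (h ▸ (similar_frobeniusForm τ).symm)

end FrobeniusForm

section Pad

variable {K : Type*} [Field K] {m n : ℕ}

theorem castSize_directSum_eq_pad {k : ℕ} {A : Matrix (Fin k) (Fin k) K} (hA : A = 1)
    (h : k + m = n) (hmn : m ≤ n) (σ : Matrix (Fin m) (Fin m) K) :
    castSize h (directSum A σ) = pad hmn σ := by
  obtain rfl : k = n - m := by omega
  rw [hA, pad]

theorem companion_X_sub_C_one : companion (X - C 1 : K[X]) = 1 := by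
  have : Subsingleton (Fin (X - C 1 : K[X]).natDegree) := by
    rw [natDegree_X_sub_C]
    infer_instance
  ext i j
  have hj : (j : ℕ) = 0 := Nat.lt_one_iff.1 (j.2.trans_eq (natDegree_X_sub_C 1))
  obtain rfl := Subsingleton.elim j i
  rw [companion, Matrix.of_apply, hj, if_pos (natDegree_X_sub_C 1).symm, Matrix.one_apply_eq]
  simp

theorem pad_companionSum (k : ℕ) {L : List K[X]} (hm : (L.map natDegree).sum = m)
    (hn : ((List.replicate k (X - C 1) ++ L).map natDegree).sum = n) (hmn : m ≤ n) :
    pad hmn (castSize hm (companionSum L)) =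
      castSize hn (companionSum (List.replicate k (X - C 1) ++ L)) := by
  subst hm hn
  induction k with
  | zero => exact pad_self _
  | succ k ih =>
    have h₁ : (L.map natDegree).sum ≤
        ((List.replicate k (X - C 1) ++ L).map natDegree).sum := by simp
    have h₂ : ((List.replicate k (X - C 1) ++ L).map natDegree).sum ≤
        ((List.replicate (k + 1) (X - C 1) ++ L).map natDegree).sum := by
      simp [List.replicate_succ]
    rw [← pad_pad h₁ h₂, ih h₁]
    exact (castSize_directSum_eq_pad companion_X_sub_C_one _ h₂ _).symm

theorem hasCyclicFactors_one (k : ℕ) :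
    HasCyclicFactors (MatrixModule (1 : Matrix (Fin k) (Fin k) K))
      (List.replicate k (X - C 1 : K[X])) := by
  have hk : ((List.replicate k (X - C 1 : K[X]) ++ []).map natDegree).sum = k := by
    simp only [List.append_nil, List.map_replicate, natDegree_X_sub_C, List.sum_replicate,
      smul_eq_mul, mul_one]
  have hone : castSize hk (companionSum (List.replicate k (X - C 1) ++ [])) = 1 := by
    rw [← pad_companionSum k rfl hk k.zero_le, ← pad_one k.zero_le]
    exact congrArg _ (Subsingleton.elim (α := Matrix (Fin 0) (Fin 0) K) _ _)
  have hmonic : ∀ P ∈ List.replicate k (X - C 1 : K[X]) ++ [], P.Monic := fun P hP =>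
    List.eq_of_mem_replicate (List.append_nil _ ▸ hP) ▸ monic_X_sub_C 1
  have h := (hasCyclicFactors_companionSum hmonic).castSize hk
  rwa [hone, List.append_nil] at h

theorem HasCyclicFactors.pad {σ : Matrix (Fin m) (Fin m) K} {L : List K[X]}
    (hσ : HasCyclicFactors (MatrixModule σ) L) (h : m ≤ n) :
    HasCyclicFactors (MatrixModule (pad h σ)) (List.replicate (n - m) (X - C 1) ++ L) := by
  obtain ⟨e⟩ := nonempty_matrixModule_directSum_linearEquiv
    (1 : Matrix (Fin (n - m)) (Fin (n - m)) K) σ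
  exact (((hasCyclicFactors_one (n - m)).prod hσ).of_linearEquiv e).castSize _

theorem IsInvariantFactors.pad {σ : Matrix (Fin m) (Fin m) K} {L : List K[X]}
    (hσ : IsInvariantFactors σ L) (hL : ∀ P ∈ L, X - C 1 ∣ P) (h : m ≤ n) :
    IsInvariantFactors (pad h σ) (List.replicate (n - m) (X - C 1) ++ L) := by
  classical
  obtain ⟨-, hσ'⟩ := isInvariantFactors_iff.1 hσ
  refine isInvariantFactors_iff.2 ⟨isInvariantFactorChain_iff.2 ⟨?_, ?_, ?_⟩, hσ'.pad h⟩
  · exact List.forall_mem_append.2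
      ⟨List.forall_mem_replicate.2 (.inr (monic_X_sub_C 1)), hσ.monic⟩
  · have hpos : 0 < (X - C 1 : K[X]).natDegree := by rw [natDegree_X_sub_C]; exact one_pos
    exact List.forall_mem_append.2 ⟨List.forall_mem_replicate.2 (.inr hpos), hσ.nonconstant⟩
  · exact List.isChain_iff_pairwise.2 (List.pairwise_append.2
      ⟨List.pairwise_replicate.2 (.inr dvd_rfl), List.isChain_iff_pairwise.1 hσ.chain,
        fun P hP Q hQ => List.eq_of_mem_replicate hP ▸ hL Q hQ⟩)

theorem frobeniusForm_pad {σ : Matrix (Fin m) (Fin m) K} {L : List K[X]}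
    (hσ : IsInvariantFactors σ L) (hL : ∀ P ∈ L, X - C 1 ∣ P) (h : m ≤ n) :
    frobeniusForm (pad h σ) = pad h (frobeniusForm σ) := by
  have hpad := hσ.pad hL h
  obtain ⟨hm, -⟩ := hσ.similar
  obtain ⟨hn, -⟩ := hpad.similar
  rw [hpad.frobeniusForm_eq hn, hσ.frobeniusForm_eq hm, pad_companionSum (n - m) hm hn h]

theorem exists_pad_forall_X_sub_C_dvd (σ : Matrix (Fin m) (Fin m) K) :
    ∃ (n : ℕ) (h : m ≤ n) (L : List K[X]),
      IsInvariantFactors (StableGL.pad h σ) L ∧ ∀ P ∈ L, X - C 1 ∣ P := by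
  classical
  obtain ⟨L, hL, -⟩ := existsUnique_isInvariantFactors σ
  obtain ⟨hchain, hσ⟩ := isInvariantFactors_iff.1 hL
  have hmn : m ≤ L.length + m := Nat.le_add_left m _
  have hpad := hσ.pad hmn
  rw [Nat.add_sub_cancel] at hpad
  refine ⟨L.length + m, hmn, _, isInvariantFactors_iff.2
    ⟨hchain.filter_map_gcd_append_map_lcm (X_sub_C_ne_zero 1), hpad.trans
      ((CyclicEquiv.replicate_append (X - C 1) L).trans (.filter_not_isUnit _))⟩, ?_⟩
  exact fun P hP => dvd_of_mem_filter_map_gcd_append_map_lcm (irreducible_X_sub_C 1) hP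

end Pad

section Stable

open Filter

variable {K : Type*} [Field K]

/-- The canonical homomorphism `GL_n(K) → GL_∞(K)`. -/
def stableHom (K : Type*) [Field K] (n : ℕ+) : GL (Fin n) K →* GLInf K :=
  MonoidHom.mk' stableClass fun A B =>
    (DirectLimit.mul_def (G := fun n : ℕ+ => GL (Fin n) K) (f := transition K) n A B).symm

theorem stableClass_representative (σ : GLInf K) (n : ℕ+) (h : minSize σ ≤ n) :
    stableClass (representative σ n h) = σ :=
  (existsUnique_representative σ n h).choose_spec.1

theorem transition_representative (σ : GLInf K) {m n : ℕ+} (h : minSize σ ≤ m) (h' : m ≤ n) :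
    transition K m n h' (representative σ m h) = representative σ n (h.trans h') :=
  stableClass_injective <| by
    rw [stableClass_transition, stableClass_representative, stableClass_representative]

theorem val_frobeniusGL {n : ℕ} (A : GL (Fin n) K) : (frobeniusGL A).val = frobeniusForm A.val :=
  rfl

theorem isConj_iff_frobeniusGL_eq {n : ℕ} {A B : GL (Fin n) K} :
    IsConj A B ↔ frobeniusGL A = frobeniusGL B := by
  rw [Units.ext_iff, val_frobeniusGL, val_frobeniusGL, ← similar_iff_frobeniusForm_eq,
    isConj_comm, isConj_iff]
  refine exists_congr fun ρ => ?_
  rw [eq_comm, Units.ext_iff, Units.val_mul, Units.val_mul]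

theorem exists_stabilizesAt (σ : GLInf K) : ∃ s : ℕ+, StabilizesAt σ s := by
  obtain ⟨s, h, L, hL, hdvd⟩ := exists_pad_forall_X_sub_C_dvd (representative σ _ le_rfl).val
  lift s to ℕ+ using (minSize σ).pos.trans_le h
  have hs : minSize σ ≤ s := h
  replace hL : IsInvariantFactors (representative σ s hs).val L := by
    rwa [← transition_representative σ le_rfl hs]
  refine ⟨s, hs, fun t ht => ?_⟩
  have hpad : transition K s t ht (frobeniusGL (representative σ s hs)) =
      frobeniusGL (representative σ t (hs.trans ht)) := by
    rw [← transition_representative σ hs ht]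
    exact Units.ext (frobeniusForm_pad hL hdvd ht).symm
  rw [← hpad, stableClass_transition]

theorem StabilizesAt.mono {σ : GLInf K} {s t : ℕ+} (h : StabilizesAt σ s) (hst : s ≤ t) :
    StabilizesAt σ t := by
  obtain ⟨hs, h⟩ := h
  exact ⟨hs.trans hst, fun u hu => (h t hst).symm.trans (h u (hst.trans hu))⟩

theorem StabilizesAt.stableFrobeniusForm_eq {σ : GLInf K} {s : ℕ+} (hσ : StabilizesAt σ s)
    (h : minSize σ ≤ s) :
    stableFrobeniusForm σ = stableClass (frobeniusGL (representative σ s h)) := by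
  have hex : ∃ s : ℕ+, StabilizesAt σ s := ⟨s, hσ⟩
  rw [stableFrobeniusForm, dif_pos hex]
  obtain ⟨_, hchosen⟩ := hex.choose_spec
  obtain ⟨_, hs⟩ := hσ
  exact (hchosen _ (le_max_left _ s)).trans (hs _ (le_max_right _ s)).symm

theorem eventually_exists_stableClass_eq (σ : GLInf K) :
    ∀ᶠ n : ℕ+ in atTop, ∃ A : GL (Fin n) K, stableClass A = σ :=
  (eventually_ge_atTop (minSize σ)).mono fun n hn => (existsUnique_representative σ n hn).exists

theorem eventually_stableClass_frobeniusGL_eq (σ : GLInf K) :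
    ∀ᶠ n : ℕ+ in atTop, ∀ A : GL (Fin n) K, stableClass A = σ →
      stableClass (frobeniusGL A) = stableFrobeniusForm σ := by
  obtain ⟨s, hs⟩ := exists_stabilizesAt σ
  filter_upwards [eventually_ge_atTop s] with n hn A hA
  obtain ⟨hmin, -⟩ := hs.mono hn
  obtain rfl : representative σ n hmin = A :=
    stableClass_injective ((stableClass_representative σ n hmin).trans hA.symm)
  exact ((hs.mono hn).stableFrobeniusForm_eq hmin).symm

theorem eventually_isConj {σ τ : GLInf K} (h : IsConj σ τ) :
    ∀ᶠ n : ℕ+ in atTop, ∀ A B : GL (Fin n) K, stableClass A = σ → stableClass B = τ →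
      IsConj A B := by
  obtain ⟨ρ, rfl⟩ := isConj_iff.1 h
  filter_upwards [eventually_exists_stableClass_eq ρ] with n ⟨C, hC⟩ A B hA hB
  refine isConj_iff.2 ⟨C, stableClass_injective (Eq.trans ?_ hB.symm)⟩
  rw [← hC, ← hA]
  change stableHom K n (C * A * C⁻¹) = stableHom K n C * stableHom K n A * (stableHom K n C)⁻¹
  rw [map_mul, map_mul, map_inv]

theorem isConj_iff_stableFrobeniusForm_eq (σ τ : GLInf K) :
    IsConj σ τ ↔ stableFrobeniusForm σ = stableFrobeniusForm τ := by
  have hσ := (eventually_exists_stableClass_eq σ).and (eventually_stableClass_frobeniusGL_eq σ)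
  have hτ := (eventually_exists_stableClass_eq τ).and (eventually_stableClass_frobeniusGL_eq τ)
  constructor
  · intro h
    obtain ⟨n, ⟨⟨⟨A, hA⟩, hFA⟩, ⟨B, hB⟩, hFB⟩, hconj⟩ :=
      ((hσ.and hτ).and (eventually_isConj h)).exists
    rw [← hFA A hA, ← hFB B hB, isConj_iff_frobeniusGL_eq.1 (hconj A B hA hB)]
  · intro h
    obtain ⟨n, ⟨⟨A, hA⟩, hFA⟩, ⟨B, hB⟩, hFB⟩ := (hσ.and hτ).exists
    have hAB : IsConj A B := isConj_iff_frobeniusGL_eq.2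
      (stableClass_injective ((hFA A hA).trans (h.trans (hFB B hB).symm)))
    rw [← hA, ← hB]
    exact (stableHom K n).map_isConj hAB

end Stable

end StableGL

end

theorem mainTheorem8 {K : Type*} [Field K] :
    -- every matrix has exactly one system of invariant factors
    (∀ (n : ℕ+) (A : Matrix (Fin n) (Fin n) K),
      ∃! L : List (Polynomial K), StableGL.IsInvariantFactors A L) ∧
    -- the stabilized Frobenius form is well defined
    (∀ σ : StableGL.GLInf K,
      (∃ s : ℕ+, StableGL.StabilizesAt σ s) ∧
      ∀ (s : ℕ+) (h : StableGL.minSize σ ≤ s), StableGL.StabilizesAt σ s →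
        StableGL.stableFrobeniusForm σ =
          StableGL.stableClass (StableGL.frobeniusGL (StableGL.representative σ s h))) ∧
    -- it classifies the conjugacy classes
    (∀ σ τ : StableGL.GLInf K,
      IsConj σ τ ↔ StableGL.stableFrobeniusForm σ = StableGL.stableFrobeniusForm τ) := by
  refine ⟨fun _ A => StableGL.existsUnique_isInvariantFactors A, fun σ => ⟨?_, ?_⟩, ?_⟩
  · exact StableGL.exists_stabilizesAt σ
  · exact fun _ h hs => hs.stableFrobeniusForm_eq h
  · exact StableGL.isConj_iff_stableFrobeniusForm_eq
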